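/- **Theorem.** Let $G=(V,E)$ be an undirected simple graph on $n \ge 2$ nodes and let $0 \le t \le f < n$ be integers. Consider synchronous networks on $G$ in the hybrid model: every node has a binary input and runs a deterministic state machine, which may depend on $G$, $f$, $t$ and the identity of the node; in each round a non-faulty node broadcasts a message (or nothing), determined by its state, identically to all of its neighbors, receives the messages of its neighbors, knowing the sender of each, and updates its state. At most $f$ nodes are Byzantine faulty and may deviate arbitrarily from the algorithm, and at most $t$ of the faulty nodes are equivocating, that is, may send different messages to different neighbors in the same round; every other faulty node sends, in each round, the same message (or nothing) to all of its neighbors. An algorithm solves Byzantine consensus if in every such execution (agreement) all non-faulty nodes output the same value, (validity) the output of each non-faulty node is the input of some non-faulty node, and (termination) every non-faulty node decides on its output after finitely many rounds. Then Byzantine consensus tolerating at most $f$ faulty nodes, of which at most $t$ are equivocating, is achievable on $G$ (i.e. some algorithm solves it) if and only if all of the following hold: (i) $G$ is $\left(\left\lfloor \frac{3(f-t)}{2}\right\rfloor + 2t + 1\right)$-connected; (ii) if $t=0$, then $G$ has minimum degree at least $2f$; (iii) if $t>0$, then every set $S \subseteq V$ with $0<|S|\le t$ has at least $2f+1$ neighbors.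 Here $G$ is $k$-connected if $n>k$ and the removal of fewer than $k$ nodes does not disconnect $G$, and a neighbor of $S$ is a node outside $S$ that is adjacent to some node of $S$. -/

import Mathlib

namespace HybridConsensus

universe u

/-- A deterministic synchronous algorithm for binary consensus on the graph `G`: a state machine for
each node. In each round a node broadcasts one element of `Option Msg` to all of its neighbors
(`none` is silence; `Msg` is arbitrary, so that one message may encode several), receives one such
element from each neighbor (knowing which neighbor it comes from), and updates its state. The
algorithm may depend on `G` and on the identity of the node. -/
structure Algorithm {V : Type u} (G : SimpleGraph V) where
  /-- local states -/
  State : Type u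
  /-- messages -/
  Msg : Type u
  /-- the initial state of a node, given its binary input -/
  init : V → Bool → State
  /-- the message that a node in a given state broadcasts to its neighbors -/
  send : V → State → Option Msg
  /-- the new state, from the old state and the messages received from the neighbors -/
  step : (v : V) → State → (G.neighborSet v → Option Msg) → State
  /-- the decision, if any, that a node in a given state has taken -/
  decision : V → State → Option Bool

/-- An execution of the algorithm `A` in the hybrid model: `faulty` is the set of faulty nodes and
`equiv` the set of equivocating faulty nodes. Faulty nodes need not follow `A`; a faulty node outside
`equiv` still has to send the same message to all its neighbors in each round. -/
structure Execution {V : Type u} {G : SimpleGraph V} (A : Algorithm G) where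
  /-- the faulty nodes -/
  faulty : Finset V
  /-- the equivocating faulty nodes -/
  equiv : Finset V
  equiv_subset : equiv ⊆ faulty
  /-- the inputs -/
  input : V → Bool
  /-- `sent r u v` is what `v` receives from its neighbor `u` in round `r`
  (meaningful only for adjacent `u`, `v`) -/
  sent : ℕ → V → V → Option A.Msg
  /-- `state r v` is the state of `v` at the beginning of round `r`
  (meaningful only for non-faulty `v`) -/
  state : ℕ → V → A.State
  state_zero : ∀ v, v ∉ faulty → state 0 v = A.init v (input v)
  state_succ : ∀ r v, v ∉ faulty →
    state (r + 1) v = A.step v (state r v) (fun u => sent r u v)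
  sent_nonfaulty : ∀ r v, v ∉ faulty → ∀ w, G.Adj v w → sent r v w = A.send v (state r v)
  sent_nonequiv : ∀ r v, v ∈ faulty → v ∉ equiv →
    ∀ w w', G.Adj v w → G.Adj v w' → sent r v w = sent r v w'

/-- In the execution `E`, the node `v` outputs `b`: its first decision is `b`. -/
def Execution.Outputs {V : Type u} {G : SimpleGraph V} {A : Algorithm G} (E : Execution A)
    (v : V) (b : Bool) : Prop :=
  ∃ r, A.decision v (E.state r v) = some b ∧ ∀ r', r' < r → A.decision v (E.state r' v) = none

/-- `A` solves Byzantine consensus in the hybrid model with at most `f` faulty nodes, of which at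
most `t` are equivocating. -/
def Algorithm.SolvesConsensus {V : Type u} {G : SimpleGraph V} (A : Algorithm G) (f t : ℕ) : Prop :=
  ∀ E : Execution A, E.faulty.card ≤ f → E.equiv.card ≤ t →
    -- agreement
    (∀ v w, v ∉ E.faulty → w ∉ E.faulty →
      ∀ b c, E.Outputs v b → E.Outputs w c → b = c) ∧
    -- validity
    (∀ v, v ∉ E.faulty → ∀ b, E.Outputs v b → ∃ w, w ∉ E.faulty ∧ E.input w = b) ∧
    -- termination
    (∀ v, v ∉ E.faulty → ∃ b, E.Outputs v b)

/-- Byzantine consensus is achievable on `G` in the hybrid model, tolerating at most `f` faulty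
nodes, of which at most `t` are equivocating. -/
def Achievable {V : Type u} (G : SimpleGraph V) (f t : ℕ) : Prop :=
  ∃ A : Algorithm G, A.SolvesConsensus f t

/-- `G` is `k`-connected: it has more than `k` nodes, and the removal of fewer than `k` nodes does
not disconnect it. -/
def IsKConnected {V : Type u} [Fintype V] (G : SimpleGraph V) (k : ℕ) : Prop :=
  k < Fintype.card V ∧ ∀ S : Finset V, S.card < k → (G.induce ((S : Set V)ᶜ)).Connected

/-- The neighbors of a set `S` of nodes: the nodes outside `S` that are adjacent to a node of `S`. -/
def setNeighbors {V : Type u} (G : SimpleGraph V) (S : Finset V) : Set V :=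
  {u | u ∉ S ∧ ∃ v ∈ S, G.Adj v u}

end HybridConsensus

/-!
Necessity. Run a solving algorithm without faults on a directed cover of `G` with nodes `V × Bool`,
where the input of a copy is its layer. If, for a choice of one copy per node, every non-faulty node
hears the chosen copies of all nodes except the equivocating ones, then this slice of the run is an
execution on `G` (`sliceExecution`): a faulty node behaves like its copy, and an equivocating one
like several copies at once. If one slice has all non-faulty inputs `false`, another has them all
`true`, and a third one meets both in non-faulty nodes, then validity and agreement clash
(`Algorithm.SolvesConsensus.false_of_slices`). A set with too few neighbors
(`Algorithm.SolvesConsensus.lt_card_setNeighbors`) and a small vertex cut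
(`Algorithm.SolvesConsensus.lt_card_of_separates`) both give such a cover.

Sufficiency. The algorithm goes through all guesses `(F, T)` of the faulty and the equivocating set,
with one phase for each. In a phase every node floods its current value, and each node `v` records
what it hears along each route. It then computes a target value `δ` from what it heard along routes
avoiding `F` from nodes outside `T`, and adopts `δ` only if that is safe: for every set `C` of at
most `f` nodes that could be the faulty ones, `v` heard `δ` from a source outside `C` along a route
avoiding `C`. Taking for `C` the actual faulty set shows that an adopted value was held by
a non-faulty node; so validity is never lost, and agreement persists once reached. Stating
acceptance through cuts `C`, instead of through `f + 1` disjoint paths, avoids Menger's theorem.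

In the phase with the correct guess all non-faulty nodes estimate the same values, because a faulty
node that does not equivocate commits itself to one value for all its neighbors. So they have a
common target, and it remains to find one that every non-faulty node holds or can safely adopt
(`Conditions.exists_adoptable`). Let `!δ` be the value of at most half of `F \ T`. If `δ` fails, a
set of nodes holding `!δ` is cut off from all nodes holding `δ` by a set `C` of at most `f` nodes
together with nodes of `T` and nodes of `F` holding `!δ`. These are fewer than the connectivity, so
the nodes holding `δ` all lie in `C`, and there are at most `f` of them. If `!δ` failed as well,
a set of nodes holding `δ` that is cut off from those holding `!δ` would contain a small set with too
few neighbors.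
-/

namespace HybridConsensus

universe u

/-! ### Outputs -/

theorem first_some_unique {α : Type*} {d : ℕ → Option α} {b c : α}
    (hb : ∃ r, d r = some b ∧ ∀ r', r' < r → d r' = none)
    (hc : ∃ r, d r = some c ∧ ∀ r', r' < r → d r' = none) : b = c := by
  obtain ⟨r, hr, hr'⟩ := hb
  obtain ⟨s, hs, hs'⟩ := hc
  rcases lt_trichotomy r s with h | rfl | h
  · simp [hs' r h] at hr
  · simpa [hr] using hs
  · simp [hr' s h] at hs

theorem Execution.Outputs.unique {V : Type u} {G : SimpleGraph V} {A : Algorithm G}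
    {E : Execution A} {v : V} {b c : Bool} (hb : E.Outputs v b) (hc : E.Outputs v c) : b = c :=
  first_some_unique hb hc

/-! ### Runs on two-layer covers -/

section Cover

variable {V : Type u} {G : SimpleGraph V} (A : Algorithm G) (src : V → Bool → V → Bool)

/-- The states in the fault-free run of `A` on the two-layer network `V × Bool`, where the node
`(v, i)` has input `i` and, for each neighbor `u` of `v` in `G`, hears the copy `(u, src v i u)`
of `u`. The network is directed: `(u, src v i u)` need not hear `(v, i)`. -/
def coverState : ℕ → V → Bool → A.State
  | 0, v, i => A.init v i
  | r + 1, v, i => A.step v (coverState r v i) (fun u => A.send u (coverState r u (src v i u)))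

/-- The copy `(v, i)` outputs `b` in the run on the cover. -/
def CoverOutputs (v : V) (i b : Bool) : Prop :=
  ∃ r, A.decision v (coverState A src r v i) = some b ∧
    ∀ r', r' < r → A.decision v (coverState A src r' v i) = none

open Classical in
/-- The execution on `G` in which each node `v` outside `F` behaves as its copy `(v, ρ v)` in the
cover: the faulty nodes `u` outside `T` broadcast what `(u, ρ u)` sends, and each `u ∈ T` sends to
every neighbor `v` what `(v, ρ v)` hears from `u` in the cover. -/
noncomputable def sliceExecution (F T : Finset V) (hTF : T ⊆ F) (ρ : V → Bool)
    (hρ : ∀ v ∉ F, ∀ u ∉ T, G.Adj v u → src v (ρ v) u = ρ u) : Execution A where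
  faulty := F
  equiv := T
  equiv_subset := hTF
  input := ρ
  sent r u v := A.send u (coverState A src r u (if u ∈ T then src v (ρ v) u else ρ u))
  state r v := coverState A src r v (ρ v)
  state_zero _ _ := rfl
  state_succ r v hv := by
    refine congrArg (A.step v _) (funext fun u => ?_)
    by_cases hu : (u : V) ∈ T
    · simp [hu]
    · simp [hu, hρ v hv u hu u.2]
  sent_nonfaulty r v hv w _ := by
    have hvT : v ∉ T := fun h => hv (hTF h)
    simp [hvT]
  sent_nonequiv r v _ hv w w' _ _ := by simp [hv]

variable {A} {src}

theorem exists_coverOutputs [Fintype V] {f t : ℕ} (hA : A.SolvesConsensus f t)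
    (hf : f < Fintype.card V) {F T : Finset V} (hTF : T ⊆ F) (hF : F.card ≤ f) (hT : T.card ≤ t)
    {ρ : V → Bool} (hρ : ∀ v ∉ F, ∀ u ∉ T, G.Adj v u → src v (ρ v) u = ρ u) :
    ∃ b, (∀ v ∉ F, CoverOutputs A src v (ρ v) b) ∧ ∃ w ∉ F, ρ w = b := by
  obtain ⟨hagr, hval, hterm⟩ := hA (sliceExecution A src F T hTF ρ hρ) hF hT
  obtain ⟨v, hv⟩ : ∃ v, v ∉ F := by
    by_contra! h
    rw [Finset.eq_univ_of_forall h, Finset.card_univ] at hF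
    omega
  obtain ⟨b, hb⟩ := hterm v hv
  refine ⟨b, fun w hw => ?_, hval v hv b hb⟩
  obtain ⟨c, hc⟩ := hterm w hw
  obtain rfl : b = c := hagr v w hv hw b c hb hc
  exact hc

theorem CoverOutputs.unique {v : V} {i b c : Bool} (hb : CoverOutputs A src v i b)
    (hc : CoverOutputs A src v i c) : b = c :=
  first_some_unique hb hc

/-- The three-scenario contradiction. In the slice on `F₀` all non-faulty inputs are `false`, in the
slice on `F₁` they are all `true`, and a third slice contains a non-faulty node of each of
the two; validity in the first two contradicts agreement in the third. -/
theorem Algorithm.SolvesConsensus.false_of_slices [Fintype V] {f t : ℕ} (hA : A.SolvesConsensus f t)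
    (hf : f < Fintype.card V) (src : V → Bool → V → Bool)
    {F₀ F₁ F T : Finset V} (hF₀ : F₀.card ≤ f) (hF₁ : F₁.card ≤ f) (hF : F.card ≤ f)
    (hTF : T ⊆ F) (hT : T.card ≤ t) {ρ₀ ρ₁ ρ : V → Bool}
    (h₀ : ∀ v ∉ F₀, ρ₀ v = false) (h₁ : ∀ v ∉ F₁, ρ₁ v = true)
    (hρ₀ : ∀ v ∉ F₀, ∀ u, G.Adj v u → src v false u = ρ₀ u)
    (hρ₁ : ∀ v ∉ F₁, ∀ u, G.Adj v u → src v true u = ρ₁ u)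
    (hρ : ∀ v ∉ F, ∀ u ∉ T, G.Adj v u → src v (ρ v) u = ρ u)
    {a b : V} (ha₀ : a ∉ F₀) (ha : a ∉ F) (haρ : ρ a = false)
    (hb₁ : b ∉ F₁) (hb : b ∉ F) (hbρ : ρ b = true) : False := by
  obtain ⟨c₀, hc₀, w₀, hw₀, rfl⟩ := exists_coverOutputs (src := src) hA hf (Finset.empty_subset F₀)
    hF₀ (by simp) (ρ := ρ₀) (fun v hv u _ h => by rw [h₀ v hv]; exact hρ₀ v hv u h)
  obtain ⟨c₁, hc₁, w₁, hw₁, rfl⟩ := exists_coverOutputs (src := src) hA hf (Finset.empty_subset F₁)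
    hF₁ (by simp) (ρ := ρ₁) (fun v hv u _ h => by rw [h₁ v hv]; exact hρ₁ v hv u h)
  obtain ⟨c, hc, -⟩ := exists_coverOutputs (src := src) hA hf hTF hF hT hρ
  have ea := hc₀ a ha₀
  have eb := hc₁ b hb₁
  have ea' := hc a ha
  have eb' := hc b hb
  rw [h₀ a ha₀, h₀ w₀ hw₀] at ea
  rw [h₁ b hb₁, h₁ w₁ hw₁] at eb
  rw [haρ] at ea'
  rw [hbρ] at eb'
  exact Bool.false_ne_true ((ea.unique ea').trans (eb'.unique eb))

end Cover

/-! ### Necessity -/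

theorem exists_subset_card_eq_min {V : Type u} (X : Finset V) (a : ℕ) :
    ∃ Y ⊆ X, Y.card = min a X.card :=
  Finset.exists_subset_card_eq (min_le_right _ _)

open Classical in
/-- A set `S` with too few neighbors: the neighbors of `S` split into `F₁`, `T` and `F₂`. The copies
of `S ∪ F₁` have input `false`, those of `F₂` have input `true`, and the other nodes have both
copies. The faulty sets are `F₂`, then `S ∪ F₁`, then `F₁ ∪ T` with `T` equivocating. -/
theorem Algorithm.SolvesConsensus.lt_card_setNeighbors {V : Type u} [Fintype V] {G : SimpleGraph V}
    {A : Algorithm G} {f t m : ℕ} (hA : A.SolvesConsensus f t) (hf : f < Fintype.card V)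
    {S : Finset V} (hS : S.Nonempty) (hSm : S.card + m ≤ f) (hmt : m + t ≤ f) :
    f + m + t < (setNeighbors G S).ncard := by
  by_contra! hN
  obtain ⟨N, hNS⟩ : ∃ N : Finset V, (N : Set V) = setNeighbors G S :=
    ⟨(setNeighbors G S).toFinset, by simp⟩
  have hmem : ∀ u, u ∈ N ↔ u ∉ S ∧ ∃ v ∈ S, G.Adj v u := fun u => by
    rw [← Finset.mem_coe, hNS]; rfl
  rw [← hNS, Set.ncard_coe_finset] at hN
  -- filling `F₂` first makes it nonempty whenever `S` has a neighbor
  obtain ⟨F₂, hF₂N, hF₂⟩ := exists_subset_card_eq_min N f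
  obtain ⟨F₁, hF₁N, hF₁⟩ := exists_subset_card_eq_min (N \ F₂) m
  have hc₂ := Finset.card_sdiff_of_subset hF₂N
  have hc₁ := Finset.card_sdiff_of_subset hF₁N
  set T := (N \ F₂) \ F₁ with hT
  have hSpos := hS.card_pos
  obtain ⟨a, ha⟩ := hS
  -- a node whose copy in the third scenario has input `true`
  obtain ⟨b, hbS, hb₁, hbT⟩ : ∃ b, b ∉ S ∧ b ∉ F₁ ∧ b ∉ T := by
    by_cases hNe : N = ∅
    · obtain ⟨b, hb⟩ : ∃ b, b ∉ S := by
        by_contra! h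
        have : S.card = Fintype.card V := by rw [Finset.eq_univ_of_forall h, Finset.card_univ]
        omega
      refine ⟨b, hb, fun h => ?_, fun h => ?_⟩
      · have := hF₁N h
        simp [hNe] at this
      · simp [hT, hNe] at h
    · have : 0 < N.card := Finset.card_pos.2 (Finset.nonempty_iff_ne_empty.2 hNe)
      obtain ⟨b, hb⟩ : F₂.Nonempty := Finset.card_pos.1 (by omega)
      refine ⟨b, ((hmem b).1 (hF₂N hb)).1, fun h => ?_, fun h => ?_⟩
      · have := hF₁N h
        simp [hb] at this
      · simp [hT, hb] at h
  have hF₂S : ∀ u ∈ F₂, u ∉ S ∧ u ∉ F₁ := fun u hu =>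
    ⟨((hmem u).1 (hF₂N hu)).1, fun h => by simpa [hu] using hF₁N h⟩
  have hTS : ∀ u ∈ T, u ∉ S ∧ u ∉ F₁ := fun u hu => by
    simp only [hT, Finset.mem_sdiff] at hu
    exact ⟨((hmem u).1 hu.1.1).1, hu.2⟩
  have hF₁S : ∀ u ∈ F₁, u ∉ S := fun u hu =>
    ((hmem u).1 (Finset.mem_sdiff.1 (hF₁N hu)).1).1
  refine hA.false_of_slices hf
    (fun _ i u => if u ∈ S ∪ F₁ then false else if u ∈ F₂ then true else i)
    (F₀ := F₂) (F₁ := S ∪ F₁) (F := F₁ ∪ T) (T := T)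
    (ρ₀ := fun u => decide (u ∈ F₂)) (ρ₁ := fun u => decide (u ∉ S ∪ F₁))
    (ρ := fun u => decide (u ∉ S ∪ F₁)) (a := a) (b := b)
    ?_ ?_ ?_ ?_ ?_ ?_ ?_ ?_ ?_ ?_ ?_ ?_ ?_ ?_ ?_ ?_
  · omega
  · exact (Finset.card_union_le _ _).trans (by omega)
  · exact (Finset.card_union_le _ _).trans (by omega)
  · exact Finset.subset_union_right
  · omega
  · simp
  · simp
  · intro v _ u _
    have := hF₂S u
    by_cases h : u ∈ F₂ <;> simp_all
  · intro v _ u _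
    by_cases h : u ∈ S ∪ F₁ <;> simp [h]
  · intro v hv u hu hvu
    by_cases h : u ∈ S ∪ F₁
    · simp [h]
    by_cases h₂ : u ∈ F₂
    · simp [h₂, h]
    simp only [Finset.mem_union, not_or] at h hv
    -- a neighbor of `S` outside `S`, `F₁` and `F₂` lies in `T`
    have : v ∉ S := fun hvS => hu (by
      simp only [hT, Finset.mem_sdiff]
      exact ⟨⟨(hmem u).2 ⟨h.1, v, hvS, hvu⟩, h₂⟩, h.2⟩)
    simp [h, h₂, this, hv.1]
  · exact fun h => (hF₂S a h).1 ha
  · simp only [Finset.mem_union, not_or]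
    exact ⟨fun h => hF₁S a h ha, fun h => (hTS a h).1 ha⟩
  · simp [ha]
  · simp [hbS, hb₁]
  · simp [hb₁, hbT]
  · simp [hbS, hb₁]

open Classical in
/-- A small vertex cut `X` separating `P` from the other nodes outside `X`: split `X` into `X₁`,
`X₂`, `X₃` and `T`. The faulty sets are `X₂ ∪ X₃`, then `X₁ ∪ X₂`, then `X₁ ∪ X₃ ∪ T` with `T`
equivocating. In the last scenario `P` lives in the layer `false`, the other side of the cut in
the layer `true`, and `X₂` hears both. -/
theorem Algorithm.SolvesConsensus.lt_card_of_separates {V : Type u} [Fintype V] {G : SimpleGraph V}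
    {A : Algorithm G} {f t : ℕ} (hA : A.SolvesConsensus f t) (htf : t ≤ f)
    (hf : f < Fintype.card V) {X P : Finset V} (hPX : Disjoint P X)
    (hsep : ∀ v ∈ P, ∀ u, G.Adj v u → u ∈ P ∨ u ∈ X) {a b : V} (ha : a ∈ P)
    (hbP : b ∉ P) (hbX : b ∉ X) :
    3 * (f - t) / 2 + 2 * t < X.card := by
  by_contra! hX
  -- `|X₁| + |X₃| + |T|`, `|X₁| + |X₂|` and `|X₂| + |X₃|` may be at most `f`; these sizes of `T`,
  -- `X₁` and `X₃` leave room for the largest possible total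
  obtain ⟨T, hTX, hT⟩ := exists_subset_card_eq_min X t
  obtain ⟨X₁, hX₁, hc₁⟩ := exists_subset_card_eq_min (X \ T) ((f - t) / 2)
  obtain ⟨X₃, hX₃, hc₃⟩ := exists_subset_card_eq_min ((X \ T) \ X₁) ((f - t + 1) / 2)
  have e₁ := Finset.card_sdiff_of_subset hTX
  have e₂ := Finset.card_sdiff_of_subset hX₁
  have e₃ := Finset.card_sdiff_of_subset hX₃
  set X₂ := ((X \ T) \ X₁) \ X₃ with hX₂
  have m₁ : ∀ u ∈ X₁, u ∈ X ∧ u ∉ T := fun u hu => by simpa using hX₁ hu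
  have m₃ : ∀ u ∈ X₃, (u ∈ X ∧ u ∉ T) ∧ u ∉ X₁ := fun u hu => by simpa using hX₃ hu
  have m₂ : ∀ u, u ∈ X₂ ↔ ((u ∈ X ∧ u ∉ T) ∧ u ∉ X₁) ∧ u ∉ X₃ := fun u => by simp [hX₂]
  have mP : ∀ u ∈ P, u ∉ X := fun u hu => Finset.disjoint_left.1 hPX hu
  refine hA.false_of_slices hf
    (fun v i u => if u ∈ X₁ ∪ X₂ then false else if u ∈ X₃ then true else
      if v ∈ X₂ then decide (u ∉ P) else i)
    (F₀ := X₂ ∪ X₃) (F₁ := X₁ ∪ X₂) (F := X₁ ∪ X₃ ∪ T) (T := T)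
    (ρ₀ := fun u => decide (u ∈ X₃)) (ρ₁ := fun u => decide (u ∉ X₁ ∪ X₂))
    (ρ := fun u => decide (u ∉ P ∧ u ∉ X₁ ∪ X₂)) (a := a) (b := b)
    ?_ ?_ ?_ ?_ ?_ ?_ ?_ ?_ ?_ ?_ ?_ ?_ ?_ ?_ ?_ ?_
  · exact (Finset.card_union_le _ _).trans (by omega)
  · exact (Finset.card_union_le _ _).trans (by omega)
  · have := Finset.card_union_le X₁ X₃
    exact (Finset.card_union_le _ _).trans (by omega)
  · exact Finset.subset_union_right
  · omega
  · simp
  · simp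
  · intro v hv u _
    simp only [Finset.mem_union, not_or] at hv
    have h₂ := m₂ u
    have h₃ := m₃ u
    by_cases hu : u ∈ X₃
    · simp [hu, h₂, h₃ hu]
    · simp [hu, hv.1]
  · intro v hv u _
    simp only [Finset.mem_union, not_or] at hv
    by_cases hu : u ∈ X₁ ∪ X₂
    · simp [hu]
    · simp [hu, hv.2]
  · intro v hv u hu hvu
    simp only [Finset.mem_union, not_or] at hv
    by_cases h : u ∈ X₁ ∪ X₂
    · simp [h]
    by_cases h₃ : u ∈ X₃
    · have : u ∉ P := fun hP => mP u hP (m₃ u h₃).1.1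
      simp [h, h₃, this]
    by_cases h₂ : v ∈ X₂
    · simp [h, h₃, h₂]
    -- now `v` and `u` lie outside the cut, hence on the same side of it
    have hvX : v ∉ X := fun hX' => h₂ ((m₂ v).2 ⟨⟨⟨hX', hv.2⟩, hv.1.1⟩, hv.1.2⟩)
    simp only [Finset.mem_union, not_or] at h
    have huX : u ∉ X := fun hX' => h.2 ((m₂ u).2 ⟨⟨⟨hX', hu⟩, h.1⟩, h₃⟩)
    have huv : u ∈ P ↔ v ∈ P :=
      ⟨fun hP => (hsep u hP v hvu.symm).resolve_right hvX,
        fun hP => (hsep v hP u hvu).resolve_right huX⟩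
    simp [h, h₃, h₂, hv, huv]
  · have := mP a ha
    simp only [Finset.mem_union, not_or]
    exact ⟨fun h => this ((m₂ a).1 h).1.1.1, fun h => this (m₃ a h).1.1⟩
  · have := mP a ha
    simp only [Finset.mem_union, not_or]
    exact ⟨⟨fun h => this (m₁ a h).1, fun h => this (m₃ a h).1.1⟩, fun h => this (hTX h)⟩
  · simp [ha]
  · simp only [Finset.mem_union, not_or]
    exact ⟨fun h => hbX (m₁ b h).1, fun h => hbX ((m₂ b).1 h).1.1.1⟩
  · simp only [Finset.mem_union, not_or]
    exact ⟨⟨fun h => hbX (m₁ b h).1, fun h => hbX (m₃ b h).1.1⟩, fun h => hbX (hTX h)⟩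
  · simp only [Finset.mem_union, not_or, decide_eq_true_eq]
    exact ⟨hbP, fun h => hbX (m₁ b h).1, fun h => hbX ((m₂ b).1 h).1.1.1⟩

open Classical in
theorem Algorithm.SolvesConsensus.induce_compl_connected {V : Type u} [Fintype V]
    {G : SimpleGraph V} {A : Algorithm G} {f t : ℕ} (hA : A.SolvesConsensus f t) (htf : t ≤ f)
    (hf : f < Fintype.card V) {X : Finset V} (hXV : X.card < Fintype.card V)
    (hX : X.card ≤ 3 * (f - t) / 2 + 2 * t) : (G.induce ((X : Set V)ᶜ)).Connected := by
  obtain ⟨c, hc⟩ : ∃ c, c ∉ X := by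
    by_contra! h
    rw [Finset.eq_univ_of_forall h, Finset.card_univ] at hXV
    omega
  have : Nonempty ((X : Set V)ᶜ : Set V) := ⟨⟨c, by simpa using hc⟩⟩
  refine ⟨fun a b => ?_⟩
  by_contra hab
  refine absurd (hA.lt_card_of_separates htf hf (X := X) (a := a) (b := b)
    (P := Finset.univ.filter fun v => ∃ h : v ∈ (X : Set V)ᶜ,
      (G.induce ((X : Set V)ᶜ)).Reachable a ⟨v, h⟩) ?_ ?_ ?_ ?_ ?_) hX.not_gt
  · rw [Finset.disjoint_left]
    intro v hv
    obtain ⟨h, -⟩ := (Finset.mem_filter.1 hv).2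
    simpa using h
  · intro v hv u hvu
    obtain ⟨h, hr⟩ := (Finset.mem_filter.1 hv).2
    by_cases hu : u ∈ X
    · exact Or.inr hu
    · have hu' : u ∈ (X : Set V)ᶜ := by simpa using hu
      refine Or.inl (Finset.mem_filter.2 ⟨Finset.mem_univ _, hu', hr.trans ?_⟩)
      exact SimpleGraph.Adj.reachable (G := G.induce ((X : Set V)ᶜ)) hvu
  · exact Finset.mem_filter.2 ⟨Finset.mem_univ _, a.2, SimpleGraph.Reachable.refl _⟩
  · intro h
    obtain ⟨_, hr⟩ := (Finset.mem_filter.1 h).2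
    exact hab hr
  · exact fun h => b.2 h

theorem setNeighbors_singleton {V : Type u} (G : SimpleGraph V) (v : V) :
    setNeighbors G {v} = G.neighborSet v := by
  ext u
  simp only [setNeighbors, Finset.mem_singleton, exists_eq_left, Set.mem_ofPred_eq,
    SimpleGraph.mem_neighborSet, and_iff_right_iff_imp]
  exact fun h => h.ne'

theorem ncard_setNeighbors_singleton {V : Type u} [Fintype V] (G : SimpleGraph V)
    [DecidableRel G.Adj] (v : V) : (setNeighbors G {v}).ncard = G.degree v := by
  rw [setNeighbors_singleton, Set.ncard_eq_toFinset_card', ← G.card_neighborSet_eq_degree,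
    Set.toFinset_card]

theorem Algorithm.SolvesConsensus.conditions {V : Type u} [Fintype V] {G : SimpleGraph V}
    [DecidableRel G.Adj] {A : Algorithm G} {f t : ℕ} (hA : A.SolvesConsensus f t) (htf : t ≤ f)
    (hf : f < Fintype.card V) (hn : 2 ≤ Fintype.card V) :
    IsKConnected G (3 * (f - t) / 2 + 2 * t + 1) ∧ (t = 0 → 2 * f ≤ G.minDegree) ∧
      (0 < t → ∀ S : Finset V, 0 < S.card → S.card ≤ t →
        2 * f + 1 ≤ (setNeighbors G S).ncard) := by
  have : Nonempty V := Fintype.card_pos_iff.1 (by omega)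
  have hdeg : t = 0 → 2 * f ≤ G.minDegree := by
    rintro rfl
    refine G.le_minDegree_of_forall_le_degree _ fun v => ?_
    rcases Nat.eq_zero_or_pos f with rfl | hf0
    · simp
    have := hA.lt_card_setNeighbors (m := f - 1) hf (Finset.singleton_nonempty v)
      (by simp; omega) (by omega)
    rw [ncard_setNeighbors_singleton] at this
    omega
  have hnbr : 0 < t → ∀ S : Finset V, 0 < S.card → S.card ≤ t →
      2 * f + 1 ≤ (setNeighbors G S).ncard := by
    intro ht S hS hSt
    have := hA.lt_card_setNeighbors (m := f - t) hf (Finset.card_pos.1 hS)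
      (by omega) (by omega)
    omega
  have hcard : 3 * (f - t) / 2 + 2 * t + 1 < Fintype.card V := by
    obtain ⟨v⟩ := this
    rcases Nat.eq_zero_or_pos t with rfl | ht
    · have := hdeg rfl
      have := G.minDegree_le_degree v
      have := G.degree_lt_card_verts v
      omega
    · obtain ⟨S, -, hS⟩ := Finset.exists_subset_card_eq
        (s := (Finset.univ : Finset V)) (n := t) (by rw [Finset.card_univ]; omega)
      have h1 := hnbr ht S (by omega) hS.le
      have hdisj : Disjoint (S : Set V) (setNeighbors G S) :=
        Set.disjoint_left.2 fun u hu hu' => hu'.1 hu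
      have h2 := Set.ncard_union_eq hdisj
      have h3 := Set.ncard_le_card ((S : Set V) ∪ setNeighbors G S)
      rw [Set.ncard_coe_finset] at h2
      rw [Nat.card_eq_fintype_card] at h3
      omega
  exact ⟨⟨hcard, fun X hX => hA.induce_compl_connected htf hf (by omega)
    (by omega)⟩, hdeg, hnbr⟩

/-! ### Routes -/

/-- `Route G X v p s`: the list `p = [u₁, …, uₖ]`, read from `v` outwards, is a walk
`v, u₁, …, uₖ = s` in `G` whose relays `u₁, …, uₖ₋₁` avoid `X`; the source `s` may lie in `X`. -/
inductive Route {V : Type u} (G : SimpleGraph V) (X : Finset V) : V → List V → V → Prop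
  | nil (v : V) : Route G X v [] v
  | direct {v s : V} : G.Adj v s → Route G X v [s] s
  | cons {v w s : V} {p : List V} : G.Adj v w → w ∉ X → Route G X w p s → Route G X v (w :: p) s

section Routes

variable {V : Type u} {G : SimpleGraph V} {X Y : Finset V}

theorem Route.mono (hXY : X ⊆ Y) {v s : V} {p : List V} (h : Route G Y v p s) :
    Route G X v p s := by
  induction h with
  | nil v => exact .nil v
  | direct h => exact .direct h
  | cons h hw _ ih => exact .cons h (fun hX => hw (hXY hX)) ih

theorem Route.snoc {v d w : V} {p : List V} (h : Route G X v p d) (hd : d ∉ X)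
    (hdw : G.Adj d w) : Route G X v (p ++ [w]) w := by
  induction h with
  | nil v => exact .direct hdw
  | direct h => exact .cons h hd (.direct hdw)
  | cons h hw _ ih => exact .cons h hw (ih hd hdw)

open Classical in
theorem exists_route_of_connected {v s : V} (hv : v ∉ X)
    (h : (G.induce (((X.erase s : Finset V) : Set V)ᶜ)).Connected) : ∃ p, Route G X v p s := by
  have key : ∀ a b : (((X.erase s : Finset V) : Set V)ᶜ : Set V),
      (G.induce (((X.erase s : Finset V) : Set V)ᶜ)).Walk a b → (b : V) = s →
        ∃ p, Route G X a p s := by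
    intro a b w hb
    induction w with
    | nil => exact ⟨[], by rw [hb]; exact .nil s⟩
    | @cons a c b hac _ ih =>
      have hac' : G.Adj a c := hac
      by_cases hc : (c : V) = s
      · exact ⟨[s], .direct (by rwa [hc] at hac')⟩
      · obtain ⟨p, hp⟩ := ih hb
        refine ⟨c :: p, .cons hac' (fun hX => c.2 ?_) hp⟩
        simp [hc, hX]
  obtain ⟨w⟩ := h.preconnected ⟨v, by simp [hv]⟩ ⟨s, by simp⟩
  exact key _ _ w rfl

/-- In a finite graph all routes that are needed have length at most one common bound. -/
theorem exists_route_length_bound [Finite V] (G : SimpleGraph V) :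
    ∃ L, ∀ (X : Finset V) (v s : V), (∃ p, Route G X v p s) →
      ∃ p, Route G X v p s ∧ p.length ≤ L := by
  have h : ∀ x : Finset V × V × V, ∃ p : List V,
      (∃ p, Route G x.1 x.2.1 p x.2.2) → Route G x.1 x.2.1 p x.2.2 := fun x => by
    by_cases hx : ∃ p, Route G x.1 x.2.1 p x.2.2
    · exact hx.imp fun p hp _ => hp
    · exact ⟨[], fun h => absurd h hx⟩
  choose p hp using h
  obtain ⟨L, hL⟩ := (Set.finite_range fun x => (p x).length).bddAbove
  exact ⟨L, fun X v s h => ⟨p (X, v, s), hp (X, v, s) h, hL ⟨(X, v, s), rfl⟩⟩⟩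

end Routes

/-! ### The adoptable value -/

open Classical in
/-- For the guess that `F` is the set of faulty nodes and `T` the set of equivocating ones, and for
the reported values `x` of the nodes outside `T`: every node `v` outside `F` that does not
hold `δ` is reached, whatever set `C` of at most `f` nodes is removed, by a node
outside `C ∪ T` that reported `δ`, along a route avoiding `F ∪ C`. -/
def Adoptable {V : Type u} (G : SimpleGraph V) (f : ℕ) (F T : Finset V) (x : V → Bool)
    (δ : Bool) : Prop :=
  ∀ v ∉ F, x v ≠ δ → ∀ C : Finset V, C.card ≤ f → v ∉ C →
    ∃ s, s ∉ T ∧ s ∉ C ∧ x s = δ ∧ ∃ p, Route G (F ∪ C) v p s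

/-- The hypotheses on `G` of the sufficiency direction, with `minDegree` spelled out as a statement
on singletons so that both cases bound the neighborhood of a set. -/
structure Conditions {V : Type u} [Fintype V] (G : SimpleGraph V) (f t : ℕ) : Prop where
  le : t ≤ f
  connected : IsKConnected G (3 * (f - t) / 2 + 2 * t + 1)
  singleton : t = 0 → ∀ v, 2 * f ≤ (setNeighbors G {v}).ncard
  small : 0 < t → ∀ S : Finset V, 0 < S.card → S.card ≤ t → 2 * f + 1 ≤ (setNeighbors G S).ncard

section Adoptable

variable {V : Type u} [Fintype V] {G : SimpleGraph V}

/-- A nonempty set with fewer than `k` neighbors in a `k`-connected graph has no non-neighbors. -/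
theorem IsKConnected.mem_or_mem_setNeighbors {k : ℕ} (hG : IsKConnected G k) {D : Finset V}
    {v : V} (hv : v ∈ D) (hD : (setNeighbors G D).ncard < k) (w : V) :
    w ∈ D ∨ w ∈ setNeighbors G D := by
  classical
  by_contra! hw
  have hconn := hG.2 (setNeighbors G D).toFinset (by rwa [← Set.ncard_eq_toFinset_card'])
  rw [Set.coe_toFinset] at hconn
  have key : ∀ a b : ((setNeighbors G D)ᶜ : Set V),
      (G.induce ((setNeighbors G D)ᶜ)).Walk a b → (a : V) ∈ D → (b : V) ∈ D := by
    intro a b p ha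
    induction p with
    | nil => exact ha
    | @cons a c b hac _ ih =>
      have hac' : G.Adj a c := hac
      refine ih ?_
      by_contra hc
      exact c.2 ⟨hc, a, ha, hac'⟩
  obtain ⟨p⟩ := hconn.preconnected ⟨v, fun h => h.1 hv⟩ ⟨w, hw.2⟩
  exact hw.1 (key _ _ p hv)

open Classical in
/-- If `δ` is not adoptable, some nonempty set `D` of non-faulty nodes holding `!δ` is cut off from
all nodes holding `δ` by a set `C` of at most `f` nodes, nodes of `T`, and nodes
of `F` that reported `!δ`. -/
theorem exists_cut_of_not_adoptable {f : ℕ} {F T : Finset V} (hTF : T ⊆ F) {x : V → Bool}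
    {δ : Bool} (h : ¬ Adoptable G f F T x δ) :
    ∃ C D : Finset V, C.card ≤ f ∧ D.Nonempty ∧ (∀ d ∈ D, d ∉ F ∧ d ∉ C ∧ x d = !δ) ∧
      ∀ u ∈ setNeighbors G D, u ∈ C ∨ u ∈ T ∨ (u ∈ F ∧ x u = !δ) := by
  simp only [Adoptable, not_forall] at h
  obtain ⟨v, hvF, hvx, C, hC, hvC, h⟩ := h
  have h' : ∀ s p, Route G (F ∪ C) v p s → s ∈ C ∨ s ∈ T ∨ x s = !δ := by
    intro s p hp
    by_contra! hs
    exact h ⟨s, hs.2.1, hs.1, by simpa using hs.2.2, p, hp⟩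
  refine ⟨C, Finset.univ.filter fun d => d ∉ F ∪ C ∧ ∃ p, Route G (F ∪ C) v p d, hC,
    ⟨v, ?_⟩, ?_, ?_⟩
  · simp only [Finset.mem_filter, Finset.mem_univ, true_and, Finset.mem_union, not_or]
    exact ⟨⟨hvF, hvC⟩, [], .nil v⟩
  · intro d hd
    simp only [Finset.mem_filter, Finset.mem_univ, true_and, Finset.mem_union, not_or] at hd
    obtain ⟨⟨hdF, hdC⟩, p, hp⟩ := hd
    exact ⟨hdF, hdC, ((h' d p hp).resolve_left hdC).resolve_left fun hT => hdF (hTF hT)⟩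
  · rintro u ⟨hu, d, hd, hdu⟩
    simp only [Finset.mem_filter, Finset.mem_univ, true_and] at hd hu
    obtain ⟨hdX, p, hp⟩ := hd
    have hr := hp.snoc hdX hdu
    have huX : u ∈ F ∪ C := by
      by_contra huX
      exact hu ⟨huX, _, hr⟩
    rcases h' u _ hr with h1 | h1 | h1
    · exact Or.inl h1
    · exact Or.inr (Or.inl h1)
    · rcases Finset.mem_union.1 huX with h2 | h2
      · exact Or.inr (Or.inr ⟨h2, h1⟩)
      · exact Or.inl h2

open Classical in
/-- Let `!δ` be the value reported by at most half of the nodes in `F \ T`. If `δ` is not adoptable,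
connectivity forces that at most `f` nodes reported `δ`; then the bounds on the neighborhoods of
small sets make `!δ` adoptable. -/
theorem Conditions.adoptable_not {f t : ℕ} (hG : Conditions G f t) {F T : Finset V}
    (hTF : T ⊆ F) (hF : F.card ≤ f) (hT : T.card ≤ t) {x : V → Bool} {δ : Bool}
    (hhalf : 2 * ((F \ T).filter fun u => x u = !δ).card ≤ f - T.card)
    (hδ : ¬ Adoptable G f F T x δ) : Adoptable G f F T x (!δ) := by
  have htf := hG.le
  by_contra hδ'
  obtain ⟨C, D, hC, ⟨v, hv⟩, hD, hDN⟩ := exists_cut_of_not_adoptable hTF hδ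
  obtain ⟨C', D', hC', hD'ne, hD', hDN'⟩ := exists_cut_of_not_adoptable hTF hδ'
  simp only [Bool.not_not] at hD' hDN'
  set A : Finset V := Finset.univ.filter fun u => u ∉ T ∧ x u = δ with hA
  have hAC : A ⊆ C := by
    have hcard : (setNeighbors G D).ncard < 3 * (f - t) / 2 + 2 * t + 1 := by
      have hsub : setNeighbors G D ⊆
          ((C ∪ (T ∪ (F \ T).filter fun u => x u = !δ) : Finset V) : Set V) := by
        intro u hu
        have := hDN u hu
        simp only [Finset.coe_union, Set.mem_union, Finset.mem_coe, Finset.mem_filter,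
          Finset.mem_sdiff]
        tauto
      have h1 := Set.ncard_le_ncard hsub (Finset.finite_toSet _)
      rw [Set.ncard_coe_finset] at h1
      have h2 := Finset.card_union_le C (T ∪ (F \ T).filter fun u => x u = !δ)
      have h3 := Finset.card_union_le T ((F \ T).filter fun u => x u = !δ)
      omega
    intro u hu
    simp only [hA, Finset.mem_filter, Finset.mem_univ, true_and] at hu
    rcases hG.connected.mem_or_mem_setNeighbors hv hcard u with h | h
    · have := (hD u h).2.2
      simp [hu.2] at this
    · rcases hDN u h with h | h | h
      · exact h
      · exact absurd h hu.1
      · simp [hu.2] at h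
  have hAf : A.card ≤ f := (Finset.card_le_card hAC).trans hC
  have hD'A : D' ⊆ A := fun d hd => by
    obtain ⟨h1, -, h3⟩ := hD' d hd
    simp only [hA, Finset.mem_filter, Finset.mem_univ, true_and]
    exact ⟨fun h => h1 (hTF h), h3⟩
  -- the neighbors of a part `S` of `D'` lie in `D'` itself or among the separating nodes
  have hbound : ∀ S ⊆ D', (setNeighbors G S).ncard ≤ 2 * f + t - S.card := by
    intro S hS
    have hsub : setNeighbors G S ⊆ (((A \ S) ∪ (C' ∪ T) : Finset V) : Set V) := by
      rintro u ⟨huS, d, hd, hdu⟩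
      simp only [Finset.coe_union, Set.mem_union, Finset.mem_coe, Finset.mem_sdiff]
      by_cases huD : u ∈ D'
      · exact Or.inl ⟨hD'A huD, huS⟩
      · rcases hDN' u ⟨huD, d, hS hd, hdu⟩ with h | h | h
        · exact Or.inr (Or.inl h)
        · exact Or.inr (Or.inr h)
        · by_cases huT : u ∈ T
          · exact Or.inr (Or.inr huT)
          · exact Or.inl ⟨by simp [hA, huT, h.2], huS⟩
    have h1 := Set.ncard_le_ncard hsub (Finset.finite_toSet _)
    rw [Set.ncard_coe_finset] at h1
    have h2 := Finset.card_union_le (A \ S) (C' ∪ T)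
    have h3 := Finset.card_union_le C' T
    have h4 := Finset.card_sdiff_of_subset (hS.trans hD'A)
    have h5 := Finset.card_le_card (hS.trans hD'A)
    omega
  rcases Nat.eq_zero_or_pos t with ht | ht
  · obtain ⟨w, hw⟩ := hD'ne
    have h1 := hG.singleton ht w
    have h2 := hbound {w} (by simpa using hw)
    have h3 : 0 < A.card := Finset.card_pos.2 ⟨w, hD'A hw⟩
    rw [Finset.card_singleton] at h2
    omega
  · rcases le_total D'.card t with hDt | hDt
    · have h1 := hG.small ht D' (Finset.card_pos.2 hD'ne) hDt
      have hsub : setNeighbors G D' ⊆ ((C' ∪ F : Finset V) : Set V) := by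
        intro u hu
        simp only [Finset.coe_union, Set.mem_union, Finset.mem_coe]
        rcases hDN' u hu with h | h | h
        · exact Or.inl h
        · exact Or.inr (hTF h)
        · exact Or.inr h.1
      have h2 := Set.ncard_le_ncard hsub (Finset.finite_toSet _)
      rw [Set.ncard_coe_finset] at h2
      have h3 := Finset.card_union_le C' F
      omega
    · obtain ⟨S, hS, hSt⟩ := Finset.exists_subset_card_eq hDt
      have h1 := hG.small ht S (by omega) hSt.le
      have h2 := hbound S hS
      omega

open Classical in
theorem Conditions.exists_adoptable {f t : ℕ} (hG : Conditions G f t) {F T : Finset V}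
    (hTF : T ⊆ F) (hF : F.card ≤ f) (hT : T.card ≤ t) (x : V → Bool) :
    ∃ δ, Adoptable G f F T x δ := by
  have hsum : ((F \ T).filter fun u => x u = true).card +
      ((F \ T).filter fun u => x u = false).card ≤ f - T.card := by
    have h1 := Finset.card_filter_add_card_filter_not (s := F \ T) (fun u => x u = true)
    have h2 := Finset.card_sdiff_of_subset hTF
    simp only [Bool.not_eq_true] at h1
    omega
  have hδ : ∃ δ, 2 * ((F \ T).filter fun u => x u = !δ).card ≤ f - T.card := by
    by_cases h : 2 * ((F \ T).filter fun u => x u = true).card ≤ f - T.card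
    · exact ⟨false, h⟩
    · exact ⟨true, by simp only [Bool.not_true]; omega⟩
  obtain ⟨δ, hδ⟩ := hδ
  by_cases h : Adoptable G f F T x δ
  · exact ⟨δ, h⟩
  · exact ⟨!δ, hG.adoptable_not hTF hF hT hδ h⟩

open Classical in
theorem Conditions.exists_route {f t : ℕ} (hG : Conditions G f t) {F : Finset V}
    (hF : F.card ≤ f) {v : V} (hv : v ∉ F) (s : V) : ∃ p, Route G F v p s := by
  have := hG.le
  have h1 := Finset.card_le_card (Finset.erase_subset s F)
  exact exists_route_of_connected hv (hG.connected.2 _ (by omega))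

end Adoptable

/-! ### One phase -/

section Phase

variable {V : Type u} (G : SimpleGraph V) (f L : ℕ)

/-- `h p` is the value that `v` heard along the route `p`. The value `b` is safe for `v` if, whatever
set `C` of at most `f` nodes is faulty, `v` heard it from a node outside `C` along a
route avoiding `C`. -/
def Safe (v : V) (h : List V → Bool) (b : Bool) : Prop :=
  ∀ C : Finset V, C.card ≤ f → v ∉ C →
    ∃ s p, s ∉ C ∧ Route G C v p s ∧ p.length ≤ L ∧ h p = b

open Classical in
/-- The value of `s` as `v` knows it, heard along some route avoiding `F`. Nodes of `T` are given the
dummy value `false`, so that all nodes obtain the same function. -/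
noncomputable def estimate (F T : Finset V) (v : V) (h : List V → Bool) (s : V) : Bool :=
  if hs : s ∉ T ∧ ∃ p, Route G F v p s ∧ p.length ≤ L then h hs.2.choose else false

open Classical in
/-- The value that the nodes are asked to adopt under the guess `(F, T)`. -/
noncomputable def target (F T : Finset V) (v : V) (h : List V → Bool) : Bool :=
  decide (Adoptable G f F T (estimate G L F T v h) true)

open Classical in
/-- The value of `v` after a phase with guess `(F, T)`: the target if it is safe, otherwise the old
value `b`. -/
noncomputable def update (F T : Finset V) (v : V) (b : Bool) (h : List V → Bool) : Bool :=
  if Safe G f L v h (target G f L F T v h) then target G f L F T v h else b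

/-- What flooding guarantees when `F` and `T` are the actual sets of faulty and of equivocating
nodes, `γ` holds the values at the start, and `h v p` is what `v` heard along `p`. -/
structure Flooded (F T : Finset V) (γ : V → Bool) (h : V → List V → Bool) : Prop where
  nil : ∀ v ∉ F, h v [] = γ v
  cons : ∀ v ∉ F, ∀ u ∉ F, G.Adj v u → ∀ q : List V, q.length < L → h v (u :: q) = h u q
  faulty : ∀ u ∈ F, u ∉ T → 0 < L → ∃ c, ∀ v ∉ F, G.Adj v u → h v [u] = c

variable {G f L} {F T : Finset V} {γ : V → Bool} {h : V → List V → Bool}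

/-- All non-faulty nodes hear the same value from a non-equivocating source, faulty or not, along
routes with non-faulty relays. -/
theorem Flooded.exists_value (hh : Flooded G L F T γ h) (hTF : T ⊆ F) :
    ∃ x : V → Bool, (∀ s ∉ F, x s = γ s) ∧ (∀ s ∈ T, x s = false) ∧
      ∀ v ∉ F, ∀ s ∉ T, ∀ p, Route G F v p s → p.length ≤ L → h v p = x s := by
  classical
  have hx : ∀ s, ∃ b, (s ∉ F → b = γ s) ∧ (s ∈ T → b = false) ∧
      (s ∉ T → 0 < L → ∀ v ∉ F, G.Adj v s → h v [s] = b) := by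
    intro s
    by_cases hsT : s ∈ T
    · exact ⟨false, fun h => absurd (hTF hsT) h, fun _ => rfl, fun h => absurd hsT h⟩
    by_cases hsF : s ∈ F
    · by_cases hL : 0 < L
      · obtain ⟨c, hc⟩ := hh.faulty s hsF hsT hL
        exact ⟨c, fun h => absurd hsF h, fun h => absurd h hsT, fun _ _ => hc⟩
      · exact ⟨false, fun h => absurd hsF h, fun _ => rfl, fun _ h => absurd h hL⟩
    · exact ⟨γ s, fun _ => rfl, fun h => absurd h hsT, fun _ hL v hv hvs => by
        rw [hh.cons v hv s hsF hvs [] hL, hh.nil s hsF]⟩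
  choose x hx₁ hx₂ hx₃ using hx
  refine ⟨x, hx₁, hx₂, fun v hv s hs p hp => ?_⟩
  induction hp with
  | nil v => exact fun _ => by rw [hh.nil v hv, hx₁ v hv]
  | @direct v s hvs => exact fun hL => hx₃ s hs hL v hv hvs
  | @cons v w s p hvw hw _ ih =>
    intro hL
    rw [List.length_cons] at hL
    rw [hh.cons v hv w hw hvw p hL, ih hw hs (by omega)]

theorem Flooded.update_valid (hh : Flooded G L F T γ h) (hTF : T ⊆ F) (hF : F.card ≤ f)
    (F' T' : Finset V) {v : V} (hv : v ∉ F) :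
    ∃ w ∉ F, update G f L F' T' v (γ v) (h v) = γ w := by
  obtain ⟨x, hx₁, -, hx⟩ := hh.exists_value hTF
  rw [update]
  split_ifs with hs
  · obtain ⟨s, p, hsF, hp, hpL, hps⟩ := hs F hF hv
    exact ⟨s, hsF, by rw [← hps, hx v hv s (fun h => hsF (hTF h)) p hp hpL, hx₁ s hsF]⟩
  · exact ⟨v, hv, rfl⟩

theorem Flooded.update_agree [Fintype V] {t : ℕ} (hG : Conditions G f t)
    (hL : ∀ (X : Finset V) (v s : V), (∃ p, Route G X v p s) →
      ∃ p, Route G X v p s ∧ p.length ≤ L)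
    (hh : Flooded G L F T γ h) (hTF : T ⊆ F) (hF : F.card ≤ f) (hT : T.card ≤ t) :
    ∃ b, ∀ v ∉ F, update G f L F T v (γ v) (h v) = b := by
  classical
  obtain ⟨x, hx₁, hx₂, hx⟩ := hh.exists_value hTF
  have hest : ∀ v ∉ F, estimate G L F T v (h v) = x := by
    intro v hv
    funext s
    by_cases hs : s ∈ T
    · rw [estimate, dif_neg (fun h => h.1 hs), hx₂ s hs]
    · have hr := hL F v s (hG.exists_route hF hv s)
      rw [estimate, dif_pos ⟨hs, hr⟩]
      exact hx v hv s hs _ hr.choose_spec.1 hr.choose_spec.2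
  obtain ⟨δ, hδ, htgt⟩ : ∃ δ, Adoptable G f F T x δ ∧
      ∀ v ∉ F, target G f L F T v (h v) = δ := by
    by_cases htrue : Adoptable G f F T x true
    · exact ⟨true, htrue, fun v hv => by simp [target, hest v hv, htrue]⟩
    · obtain ⟨δ, hδ⟩ := hG.exists_adoptable hTF hF hT x
      obtain rfl : δ = false := by
        cases δ
        · rfl
        · exact absurd hδ htrue
      exact ⟨false, hδ, fun v hv => by simp [target, hest v hv, htrue]⟩
  refine ⟨δ, fun v hv => ?_⟩
  rw [update, htgt v hv, if_pos]
  intro C hC hvC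
  by_cases hvδ : x v = δ
  · exact ⟨v, [], hvC, .nil v, Nat.zero_le _, by rw [hh.nil v hv, ← hx₁ v hv, hvδ]⟩
  · obtain ⟨s, hsT, hsC, hsδ, hr⟩ := hδ v hv hvδ C hC hvC
    obtain ⟨p, hp, hpL⟩ := hL _ v s hr
    exact ⟨s, p, hsC, hp.mono Finset.subset_union_right, hpL,
      by rw [hx v hv s hsT p (hp.mono Finset.subset_union_left) hpL, hsδ]⟩

end Phase

/-! ### The algorithm -/

/-- The local state: the index of the current phase, the round within it, the value at the start of
the phase, and the values heard along the lists of relays so far. -/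
structure FloodState (V : Type u) where
  phase : ℕ
  tick : ℕ
  value : Bool
  heard : List V → Bool

section Algorithm

variable {V : Type u} (G : SimpleGraph V) (f L M : ℕ) (guess : ℕ → Finset V × Finset V)

/-- What a message reports to have been heard along `q`; silence counts as `false`. -/
def report {V : Type u} (m : Option (List V → Bool)) (q : List V) : Bool :=
  m.elim false fun h => h q

open Classical in
/-- The values heard by `v` after the round `i` of a phase: what the neighbor `u` reports having
heard along `q` is recorded for `u :: q`, but only in the round `q.length`, so that later
contradictory reports of a faulty neighbor are ignored. -/
noncomputable def hear (v : V) (i : ℕ) (h : List V → Bool)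
    (inbox : G.neighborSet v → Option (List V → Bool)) : List V → Bool
  | [] => h []
  | u :: q =>
    if q.length = i then
      if hu : G.Adj v u then report (inbox ⟨u, hu⟩) q else false
    else h (u :: q)

/-- Flooding in phases of `L + 1` rounds. In each of the first `L` rounds of a phase every node
broadcasts all it has heard; in the last one it updates its value for the guess that belongs to the
phase. The value after `M` phases is the decision. -/
noncomputable def floodAlgorithm : Algorithm G where
  State := FloodState V
  Msg := List V → Bool
  init _ b := ⟨0, 0, b, fun _ => b⟩
  send _ st := some st.heard
  step v st inbox :=
    if st.tick < L then ⟨st.phase, st.tick + 1, st.value, hear G v st.tick st.heard inbox⟩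
    else
      let b := update G f L (guess st.phase).1 (guess st.phase).2 v st.value st.heard
      ⟨st.phase + 1, 0, b, fun _ => b⟩
  decision _ st := if M ≤ st.phase then some st.value else none

variable {G f L M guess} (E : Execution (floodAlgorithm G f L M guess))

/-- The value of `v` at the start of the phase `j`. -/
def Execution.valueAt (j : ℕ) (v : V) : Bool :=
  FloodState.value (E.state (j * (L + 1)) v)

/-- What `v` has heard at the start of the round `i` of the phase `j`. -/
def Execution.heardAt (j i : ℕ) (v : V) : List V → Bool :=
  FloodState.heard (E.state (j * (L + 1) + i) v)

variable {E}

theorem Execution.state_succ_of_lt {r : ℕ} {v : V} (hv : v ∉ E.faulty) {j i : ℕ} {b : Bool}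
    {h : List V → Bool} (hst : E.state r v = FloodState.mk j i b h) (hi : i < L) :
    E.state (r + 1) v =
      FloodState.mk j (i + 1) b (hear G v i h fun u => E.sent r u v) := by
  rw [E.state_succ r v hv, hst]
  exact if_pos hi

theorem Execution.state_succ_of_eq {r : ℕ} {v : V} (hv : v ∉ E.faulty) {j : ℕ} {b : Bool}
    {h : List V → Bool} (hst : E.state r v = FloodState.mk j L b h) :
    E.state (r + 1) v =
      FloodState.mk (j + 1) 0 (update G f L (guess j).1 (guess j).2 v b h)
        (fun _ => update G f L (guess j).1 (guess j).2 v b h) := by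
  rw [E.state_succ r v hv, hst]
  exact if_neg (lt_irrefl L)

theorem Execution.state_add {v : V} (hv : v ∉ E.faulty) {j : ℕ} {b : Bool}
    (h0 : E.state (j * (L + 1)) v = FloodState.mk j 0 b (fun _ => b)) {i : ℕ} (hi : i ≤ L) :
    ∃ h, E.state (j * (L + 1) + i) v = FloodState.mk j i b h := by
  induction i with
  | zero => exact ⟨_, h0⟩
  | succ i ih =>
    obtain ⟨h, hst⟩ := ih (by omega)
    exact ⟨_, Execution.state_succ_of_lt hv hst (by omega)⟩

theorem Execution.state_start {v : V} (hv : v ∉ E.faulty) (j : ℕ) :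
    E.state (j * (L + 1)) v = FloodState.mk j 0 (E.valueAt j v) (fun _ => E.valueAt j v) := by
  obtain ⟨b, hb⟩ : ∃ b, E.state (j * (L + 1)) v = FloodState.mk j 0 b (fun _ => b) := by
    induction j with
    | zero => exact ⟨E.input v, by rw [zero_mul, E.state_zero v hv]; rfl⟩
    | succ j ih =>
      obtain ⟨b, hb⟩ := ih
      obtain ⟨h, hst⟩ := Execution.state_add hv hb le_rfl
      have := Execution.state_succ_of_eq hv hst
      rw [show j * (L + 1) + L + 1 = (j + 1) * (L + 1) by ring] at this
      exact ⟨_, this⟩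
  have : E.valueAt j v = b := by rw [Execution.valueAt, hb]
  rw [hb, this]

theorem Execution.state_eq {v : V} (hv : v ∉ E.faulty) (j : ℕ) {i : ℕ} (hi : i ≤ L) :
    E.state (j * (L + 1) + i) v = FloodState.mk j i (E.valueAt j v) (E.heardAt j i v) := by
  obtain ⟨h, hst⟩ := Execution.state_add hv (Execution.state_start hv j) hi
  have : E.heardAt j i v = h := by rw [Execution.heardAt, hst]
  rw [hst, this]

theorem Execution.valueAt_zero {v : V} (hv : v ∉ E.faulty) : E.valueAt 0 v = E.input v := by
  rw [Execution.valueAt, zero_mul, E.state_zero v hv]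
  rfl

theorem Execution.valueAt_succ {v : V} (hv : v ∉ E.faulty) (j : ℕ) :
    E.valueAt (j + 1) v =
      update G f L (guess j).1 (guess j).2 v (E.valueAt j v) (E.heardAt j L v) := by
  rw [Execution.valueAt, show (j + 1) * (L + 1) = j * (L + 1) + L + 1 by ring,
    Execution.state_succ_of_eq hv (Execution.state_eq hv j le_rfl)]

theorem Execution.heardAt_succ {v : V} (hv : v ∉ E.faulty) (j : ℕ) {i : ℕ} (hi : i < L) :
    E.heardAt j (i + 1) v =
      hear G v i (E.heardAt j i v) fun u => E.sent (j * (L + 1) + i) u v := by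
  rw [Execution.heardAt, ← add_assoc,
    Execution.state_succ_of_lt hv (Execution.state_eq hv j hi.le) hi]

/-- Once recorded, a value heard does not change within the phase. -/
theorem Execution.heardAt_eq_of_le {v : V} (hv : v ∉ E.faulty) (j : ℕ) {p : List V} {i : ℕ}
    (hp : p.length ≤ i) (hi : i ≤ L) : E.heardAt j i v p = E.heardAt j p.length v p := by
  induction i, hp using Nat.le_induction with
  | base => rfl
  | succ i hpi ih =>
    rw [← ih (by omega), Execution.heardAt_succ hv j (by omega)]
    cases p with
    | nil => rfl
    | cons u q =>
      rw [List.length_cons] at hpi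
      simp only [hear]
      rw [if_neg (by omega)]

theorem Execution.heardAt_cons {v u : V} (hv : v ∉ E.faulty) (huv : G.Adj v u) (j : ℕ)
    {q : List V} (hq : q.length < L) :
    E.heardAt j L v (u :: q) = report (E.sent (j * (L + 1) + q.length) u v) q := by
  rw [Execution.heardAt_eq_of_le hv j (p := u :: q) (by simpa using hq) le_rfl, List.length_cons,
    Execution.heardAt_succ hv j hq]
  exact (if_pos rfl).trans (dif_pos huv)

theorem Execution.flooded (E : Execution (floodAlgorithm G f L M guess)) (j : ℕ) :
    Flooded G L E.faulty E.equiv (E.valueAt j) (E.heardAt j L) where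
  nil v hv := by
    rw [Execution.heardAt_eq_of_le hv j (p := []) (Nat.zero_le _) le_rfl, Execution.heardAt,
      List.length_nil, add_zero, Execution.state_start hv j]
  cons v hv u hu hvu q hq := by
    rw [Execution.heardAt_cons hv hvu j hq, E.sent_nonfaulty _ u hu v hvu.symm,
      Execution.state_eq hu j hq.le, Execution.heardAt_eq_of_le hu j hq.le le_rfl]
    rfl
  faulty u hu huT hL := by
    by_cases hw : ∃ w ∉ E.faulty, G.Adj w u
    · obtain ⟨w, hw, hwu⟩ := hw
      refine ⟨E.heardAt j L w [u], fun v hv hvu => ?_⟩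
      rw [Execution.heardAt_cons hv hvu j (q := []) hL,
        Execution.heardAt_cons hw hwu j (q := []) hL, E.sent_nonequiv _ u hu huT v w hvu.symm hwu.symm]
    · exact ⟨false, fun v hv hvu => absurd ⟨v, hv, hvu⟩ hw⟩

theorem Execution.outputs_valueAt {v : V} (hv : v ∉ E.faulty) : E.Outputs v (E.valueAt M v) := by
  refine ⟨M * (L + 1), ?_, fun r hr => ?_⟩
  · rw [Execution.state_start hv M]
    exact if_pos le_rfl
  · have hr' := Nat.div_add_mod' r (L + 1)
    have hi : r % (L + 1) ≤ L := Nat.le_of_lt_succ (Nat.mod_lt _ (Nat.succ_pos L))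
    have hj : r / (L + 1) < M := (Nat.div_lt_iff_lt_mul (Nat.succ_pos L)).2 hr
    rw [← hr', Execution.state_eq hv _ hi]
    exact if_neg hj.not_ge

theorem Execution.valueAt_valid (hF : E.faulty.card ≤ f) (i j : ℕ) {v : V} (hv : v ∉ E.faulty) :
    ∃ w ∉ E.faulty, E.valueAt (i + j) v = E.valueAt i w := by
  induction j generalizing v with
  | zero => exact ⟨v, hv, rfl⟩
  | succ j ih =>
    obtain ⟨w, hw, hvw⟩ := (E.flooded (i + j)).update_valid E.equiv_subset hF
      (guess (i + j)).1 (guess (i + j)).2 hv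
    obtain ⟨w', hw', hww'⟩ := ih hw
    exact ⟨w', hw', by rw [← add_assoc, Execution.valueAt_succ hv, hvw, hww']⟩

/-- Agreement is reached in the phase whose guess is correct and is preserved by validity. -/
theorem floodAlgorithm_solvesConsensus [Fintype V] {t : ℕ} (hG : Conditions G f t)
    (hL : ∀ (X : Finset V) (v s : V), (∃ p, Route G X v p s) →
      ∃ p, Route G X v p s ∧ p.length ≤ L)
    (hM : ∀ FT, ∃ j < M, guess j = FT) :
    (floodAlgorithm G f L M guess).SolvesConsensus f t := by
  intro E hF hT
  refine ⟨fun v w hv hw b c hb hc => ?_, fun v hv b hb => ?_,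
    fun v hv => ⟨_, Execution.outputs_valueAt hv⟩⟩
  · obtain ⟨j, hjM, hj⟩ := hM (E.faulty, E.equiv)
    obtain ⟨d, hd⟩ := (E.flooded j).update_agree hG hL E.equiv_subset hF hT
    have key : ∀ v ∉ E.faulty, E.valueAt M v = d := by
      intro v hv
      obtain ⟨k, hk⟩ := Nat.exists_eq_add_of_le (Nat.succ_le_of_lt hjM)
      obtain ⟨w, hw, hvw⟩ := Execution.valueAt_valid hF (j + 1) k hv
      rw [← hk] at hvw
      rw [hvw, Execution.valueAt_succ hw, hj, hd w hw]
    rw [hb.unique (Execution.outputs_valueAt hv), hc.unique (Execution.outputs_valueAt hw),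
      key v hv, key w hw]
  · obtain ⟨w, hw, hvw⟩ := Execution.valueAt_valid hF 0 M hv
    refine ⟨w, hw, ?_⟩
    rw [zero_add, Execution.valueAt_zero hw] at hvw
    rw [hb.unique (Execution.outputs_valueAt hv), hvw]

theorem Conditions.achievable [Fintype V] {t : ℕ} (hG : Conditions G f t) : Achievable G f t := by
  classical
  obtain ⟨L, hL⟩ := exists_route_length_bound G
  let e := Fintype.equivFin (Finset V × Finset V)
  refine ⟨floodAlgorithm G f L (Fintype.card (Finset V × Finset V))
    (fun j => if h : j < _ then e.symm ⟨j, h⟩ else (∅, ∅)),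
    floodAlgorithm_solvesConsensus hG hL fun FT => ⟨e FT, (e FT).2, ?_⟩⟩
  simp only [Fin.is_lt, dif_pos, Fin.eta, Equiv.symm_apply_apply]

end Algorithm

end HybridConsensus

theorem mainTheorem3 {V : Type*} [Fintype V] (G : SimpleGraph V) [DecidableRel G.Adj]
    (f t : ℕ) (htf : t ≤ f) (hfn : f < Fintype.card V) (hn : 2 ≤ Fintype.card V) :
    HybridConsensus.Achievable G f t ↔
      (HybridConsensus.IsKConnected G (3 * (f - t) / 2 + 2 * t + 1) ∧
        (t = 0 → 2 * f ≤ G.minDegree) ∧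
        (0 < t → ∀ S : Finset V, 0 < S.card → S.card ≤ t →
          2 * f + 1 ≤ (HybridConsensus.setNeighbors G S).ncard)) := by
  constructor
  · rintro ⟨A, hA⟩
    exact hA.conditions htf hfn hn
  · rintro ⟨hconn, hdeg, hnbr⟩
    refine HybridConsensus.Conditions.achievable ⟨htf, hconn, fun ht v => ?_, hnbr⟩
    rw [HybridConsensus.ncard_setNeighbors_singleton]
    exact (hdeg ht).trans (G.minDegree_le_degree v)
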